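/- Let $M$ be a smooth manifold of dimension $m\ge 1$, oriented by its atlas of positive charts $(x^a)$, with a smooth nondegenerate metric $g$ (for instance a Lorentz metric, $m=4$). Let $\Gamma_a{}^c{}_b$ be the coefficients of its Levi-Civita connection, with the sign convention $\nabla_a v^c=\partial_a v^c-\Gamma_a{}^c{}_b v^b$. Let $E\to M$ be a smooth complex vector bundle of rank $n$ with a fibre structure whose special frames are related by transition functions with values in a group $G\subset \mathrm{GL}(n,\mathbb C)$ (for instance a Hermitian structure with $G=U(n)$), and let $\mathfrak g$ be the Lie algebra of $G$. Let $C_G\to M$ be the affine bundle, modelled on $T^*M\otimes\mathfrak L$ with $\mathfrak L\subset\operatorname{End}E$ the Lie-algebra bundle, whose sections $\kappa$ (the gauge fields) are the linear connections $\nabla_a s=\partial_a s-\kappa_a s$ of $E$ that preserve the structure. A chart of $M$ and a special frame of $E$ (an adapted chart) give coordinates $(x^a,y_a)$ on $C_G$ and $(x^a,y_a,y_{a,b})$ on the jet bundle $JC_G$, with $y_a,y_{a,b}\in\mathfrak g$ and $y_{a,b}\circ \mathrm j\kappa=\partial_b\kappa_a$. Put $\langle A,B\rangle=-\operatorname{Re}\operatorname{Tr}(A\circ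 B)$, which is $\operatorname{Re}\operatorname{Tr}(A^\dagger\circ B)$ for anti-Hermitian $A$, and write $d^mx=dx^1\wedge\dots\wedge dx^m$, $dx_a=i_{\partial x_a}d^mx$. Define: 1. the curvature $\rho_{ab}=y_{a,b}-y_{b,a}+[y_a,y_b]$ and the Yang–Mills Lagrangian $\mathcal L_{\rm gauge}=\ell\, d^mx$ with $\ell=-\tfrac14\, g^{ac}g^{bd}\langle\rho_{ab},\rho_{cd}\rangle\sqrt{|\det g|}$; 2. the momentum $P^{a\,c}=\partial\ell/\partial y_{c,a}$ (with values in $\mathfrak g^*$), the momentum form $\mathcal P_{\rm gauge}=P^{a\,c}\,(dy_c-y_{c,b}\,dx^b)\wedge dx_a$, and the gauge Poincaré–Cartan form $\mathcal C_{\rm gauge}=\mathcal L_{\rm gauge}+\mathcal P_{\rm gauge}$ on $JC_G$; 3. for a gauge field $\kappa$, the overconnection $\kappa^{\uparrow}=dx^a\otimes(\partial x_a+(\kappa^\uparrow_a)_b\,\partial y^b)$ of $C_G\to M$ with $(\kappa^{\uparrow}_a)_b=\partial_b\kappa_a+[\kappa_a,y_b]+\Gamma_a{}^c{}_b\,(\kappa_c-y_c)$,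 and, for a vector field $X$ on $M$, the horizontal lift $Y=X\rfloor\kappa^\uparrow=X^a(\partial x_a+(\kappa^\uparrow_a)_b\,\partial y^b):C_G\to TC_G$; 4. the covariant derivative of $\kappa$ with respect to $\kappa^\uparrow$, $\nabla_b\kappa_c=\partial_b\kappa_c-(\kappa^\uparrow_b)_c\circ\kappa$, and the gauge canonical energy-tensor $\mathcal U_{\rm gauge}=(\ell\,\delta^a_b-P^{a\,c}\,\nabla_b\kappa_c)\,dx_a\otimes dx^b$, regarded as a morphism $JC_G\to\Lambda^{m-1}T^*M\otimes T^*M$. Theorem. For every smooth section $\kappa:M\to C_G$ and every vector field $X$ on $M$, in the domain of every adapted chart, $$(\mathcal U_{\rm gauge}\circ \mathrm j\kappa)\rfloor X=\mathrm j\kappa^*\bigl(i_Y\,\mathcal C_{\rm gauge}\bigr).$$ -/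

import Mathlib

open Set Filter Topology Manifold Bundle ContDiff

namespace YangMills

/-! ### Model spaces -/

/-- The model space `ℝ^m` of the base manifold, `m = d + 1`. -/
abbrev Coord (d : ℕ) := EuclideanSpace ℝ (Fin (d + 1))

/-- The model fibre `ℂ^n` of the vector bundle. -/
abbrev Fib (n : ℕ) := EuclideanSpace ℂ (Fin n)

/-- Endomorphisms of the model fibre. -/
abbrev EndFib (n : ℕ) := Fib n →L[ℂ] Fib n

/-- The standard basis vectors of `ℝ^m`. -/
noncomputable abbrev basisVec {d : ℕ} (a : Fin (d + 1)) : Coord d := EuclideanSpace.single a 1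

noncomputable instance (n : ℕ) : NormedRing (EndFib n) := inferInstance
noncomputable instance (n : ℕ) : NormedAlgebra ℝ (EndFib n) := inferInstance
instance (n : ℕ) : T2Space (EndFib n) := inferInstance
instance (n : ℕ) : ContinuousSMul ℝ (EndFib n) := inferInstance
instance (n : ℕ) : CompleteSpace (EndFib n) := inferInstance
instance (n : ℕ) : FiniteDimensional ℝ (EndFib n) := FiniteDimensional.complexToReal _

variable {n d : ℕ}

/-! ### The Lie algebra of the structure group -/

theorem exists_curve_add {G : Subgroup (EndFib n)ˣ} {A B : EndFib n}
  (hA : ∃ γ : ℝ → EndFib n, (∀ᶠ t in 𝓝 0, ∃ u ∈ G, (u : EndFib n) = γ t) ∧ γ 0 = 1 ∧ HasDerivAt γ A 0)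
  (hB : ∃ γ : ℝ → EndFib n, (∀ᶠ t in 𝓝 0, ∃ u ∈ G, (u : EndFib n) = γ t) ∧ γ 0 = 1 ∧ HasDerivAt γ B 0) :
  ∃ γ : ℝ → EndFib n, (∀ᶠ t in 𝓝 0, ∃ u ∈ G, (u : EndFib n) = γ t) ∧ γ 0 = 1 ∧ HasDerivAt γ (A + B) 0 := by
  obtain ⟨γ, h1, h2, h3⟩ := hA
  obtain ⟨δ, k1, k2, k3⟩ := hB
  refine ⟨fun t => γ t * δ t, ?_, by simp [h2, k2], ?_⟩
  · filter_upwards [h1, k1] with t ⟨u, hu, hu'⟩ ⟨v, hv, hv'⟩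
    exact ⟨u * v, G.mul_mem hu hv, by simp [hu', hv']⟩
  · have := h3.mul k3
    rw [h2, k2, mul_one, one_mul] at this
    exact this

theorem exists_curve_smul {G : Subgroup (EndFib n)ˣ} {A : EndFib n} (c : ℝ)
  (hA : ∃ γ : ℝ → EndFib n, (∀ᶠ t in 𝓝 0, ∃ u ∈ G, (u : EndFib n) = γ t) ∧ γ 0 = 1 ∧ HasDerivAt γ A 0) :
  ∃ γ : ℝ → EndFib n, (∀ᶠ t in 𝓝 0, ∃ u ∈ G, (u : EndFib n) = γ t) ∧ γ 0 = 1 ∧ HasDerivAt γ (c • A) 0 := by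
  obtain ⟨γ, h1, h2, h3⟩ := hA
  refine ⟨fun t => γ (c * t), ?_, by simp [h2], ?_⟩
  · have : Tendsto (fun t : ℝ => c * t) (𝓝 0) (𝓝 0) := by
      have : Continuous (fun t : ℝ => c * t) := by fun_prop
      simpa using this.tendsto 0
    exact this.eventually h1
  · have h3' : HasDerivAt γ A (c * 0) := by simpa using h3
    have := h3'.scomp (0:ℝ) ((hasDerivAt_id (0:ℝ)).const_mul c)
    simpa [Function.comp_def] using this

/-- The Lie algebra `𝔤` of a group `G` of automorphisms of the fibre, as the real vector space of
all velocities at the identity of curves in `G`. -/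
def lieAlg (G : Subgroup (EndFib n)ˣ) : Submodule ℝ (EndFib n) where
  carrier := {A | ∃ γ : ℝ → EndFib n,
    (∀ᶠ t in 𝓝 0, ∃ u ∈ G, (u : EndFib n) = γ t) ∧ γ 0 = 1 ∧ HasDerivAt γ A 0}
  add_mem' := exists_curve_add
  zero_mem' := ⟨fun _ => 1, Eventually.of_forall fun _ => ⟨1, G.one_mem, rfl⟩, rfl,
    hasDerivAt_const _ _⟩
  smul_mem' c _ h := exists_curve_smul c h

noncomputable instance (G : Subgroup (EndFib n)ˣ) : NormedAddCommGroup (lieAlg G) :=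
  Submodule.normedAddCommGroup _

noncomputable instance (G : Subgroup (EndFib n)ˣ) : NormedSpace ℝ (lieAlg G) :=
  Submodule.normedSpace _

noncomputable instance (d : ℕ) (G : Subgroup (EndFib n)ˣ) : AddCommGroup (Fin (d + 1) → lieAlg G) :=
  Pi.addCommGroup

noncomputable instance (d : ℕ) (G : Subgroup (EndFib n)ˣ) : Module ℝ (Fin (d + 1) → lieAlg G) :=
  Pi.module _ _ _

instance (d : ℕ) (G : Subgroup (EndFib n)ˣ) : ContinuousSMul ℝ (Fin (d + 1) → lieAlg G) :=
  inferInstance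

noncomputable instance (d : ℕ) (G : Subgroup (EndFib n)ˣ) :
    NormedAddCommGroup (Fin (d + 1) → lieAlg G) :=
  Pi.normedAddCommGroup

noncomputable instance (d : ℕ) (G : Subgroup (EndFib n)ˣ) :
    NormedSpace ℝ (Fin (d + 1) → lieAlg G) :=
  Pi.normedSpace

theorem conj_mem_lieAlg {G : Subgroup (EndFib n)ˣ} {u : (EndFib n)ˣ} (hu : u ∈ G) {A : EndFib n}
    (hA : A ∈ lieAlg G) : (u : EndFib n) * A * (u⁻¹ : (EndFib n)ˣ) ∈ lieAlg G := by
  obtain ⟨γ, h1, h2, h3⟩ := hA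
  refine ⟨fun t => u * γ t * (u⁻¹ : (EndFib n)ˣ), ?_, by simp [h2], ?_⟩
  · filter_upwards [h1] with t ⟨v, hv, hv'⟩
    exact ⟨u * v * u⁻¹, G.mul_mem (G.mul_mem hu hv) (G.inv_mem hu), by simp [hv']⟩
  · exact (h3.const_mul _).mul_const _

theorem lie_mem_lieAlg {G : Subgroup (EndFib n)ˣ} {A B : EndFib n}
    (hA : A ∈ lieAlg G) (hB : B ∈ lieAlg G) : A * B - B * A ∈ lieAlg G := by
  obtain ⟨γ, h1, h2, h3⟩ := hA
  have hinv : HasDerivAt (fun t => Ring.inverse (γ t)) (-A) 0 := by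
    have h := hasFDerivAt_ringInverse (𝕜 := ℝ) (1 : (EndFib n)ˣ)
    rw [Units.val_one, ← h2] at h
    have := h.comp_hasDerivAt (0:ℝ) h3
    refine this.congr_deriv ?_
    rw [neg_apply, ContinuousLinearMap.mulLeftRight_apply]
    simp
  have hd : HasDerivAt (fun t => γ t * B * Ring.inverse (γ t)) (A * B - B * A) 0 := by
    have := (h3.mul_const B).mul hinv
    refine this.congr_deriv ?_
    rw [h2, Ring.inverse_one, mul_one, one_mul]
    ext v
    simp [sub_eq_add_neg]
  have hcl : IsClosed (lieAlg G : Set (EndFib n)) := (lieAlg G).closed_of_finiteDimensional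
  have ht := hd.tendsto_slope
  refine hcl.mem_of_tendsto ht ?_
  filter_upwards [h1.filter_mono nhdsWithin_le_nhds] with t ⟨u, hu, hu'⟩
  rw [slope_def_module]
  refine (lieAlg G).smul_mem _ ((lieAlg G).sub_mem ?_ ?_)
  · rw [← hu', Ring.inverse_unit]; exact conj_mem_lieAlg hu hB
  · simpa [h2] using hB

/-- The commutator bracket of `𝔤`. -/
noncomputable def brk {G : Subgroup (EndFib n)ˣ} (A B : lieAlg G) : lieAlg G :=
  ⟨(A : EndFib n) * B - B * A, lie_mem_lieAlg A.2 B.2⟩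

/-- The contraction of the element of `𝔤*` obtained from `A` by minus transposition with `B`,
that is `- Re Tr (A ∘ B)`. -/
noncomputable def pairing {G : Subgroup (EndFib n)ˣ} (A B : lieAlg G) : ℝ :=
  -(LinearMap.trace ℂ (Fib n) ((A : EndFib n) * B).toLinearMap).re

/-- On anti-Hermitian elements `pairing` is index lowering with respect to the Hermitian structure
`(A, B) ↦ Tr (A† ∘ B)` of the endomorphisms. -/
theorem pairing_eq {G : Subgroup (EndFib n)ˣ} (A B : lieAlg G)
    (hA : ContinuousLinearMap.adjoint (A : EndFib n) = -(A : EndFib n)) :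
    pairing A B = (LinearMap.trace ℂ (Fib n) (ContinuousLinearMap.adjoint (A : EndFib n) * B).toLinearMap).re := by
  rw [hA, pairing]; simp

open Classical in
/-- An endomorphism lying in `𝔤`, as an element of `𝔤`. -/
noncomputable def toLie (G : Subgroup (EndFib n)ˣ) (A : EndFib n) : lieAlg G :=
  if h : A ∈ lieAlg G then ⟨A, h⟩ else 0

theorem toLie_coe {G : Subgroup (EndFib n)ˣ} {A : EndFib n} (h : A ∈ lieAlg G) :
    (toLie G A : EndFib n) = A := by simp [toLie, h]

theorem contMDiffOn_lieAlg {G : Subgroup (EndFib n)ˣ} {E H N : Type*} [NormedAddCommGroup E]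
    [NormedSpace ℝ E] [TopologicalSpace H] {I : ModelWithCorners ℝ E H} [TopologicalSpace N]
    [ChartedSpace H N] {f : N → lieAlg G} {s : Set N}
    (hf : ContMDiffOn I 𝓘(ℝ, EndFib n) ∞ (fun x => (f x : EndFib n)) s) :
    ContMDiffOn I 𝓘(ℝ, lieAlg G) ∞ f s := by
  obtain ⟨P, hP⟩ := Submodule.ClosedComplemented.of_finiteDimensional (lieAlg G)
  have := P.contMDiff.comp_contMDiffOn hf
  exact this.congr fun x _ => (hP (f x)).symm

/-! ### Derivatives in charts -/

section charts

variable {M : Type*} [TopologicalSpace M]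

/-- The derivative at `x` of a map `f` on `M`, in the coordinates of the chart `φ`: applied to
`basisVec a` it is `∂f/∂x^a`. -/
noncomputable def chartDeriv {N : Type*} [NormedAddCommGroup N] [NormedSpace ℝ N]
    (φ : OpenPartialHomeomorph M (Coord d)) (f : M → N) (x : M) : Coord d →L[ℝ] N :=
  fderiv ℝ (f ∘ φ.symm) (φ x)

variable {N : Type*} [NormedAddCommGroup N] [NormedSpace ℝ N]

theorem eventually_symm_mem {φ : OpenPartialHomeomorph M (Coord d)} {U : Set M} (hU : IsOpen U)
    {x : M} (hx : x ∈ φ.source) (hxU : x ∈ U) : ∀ᶠ u in 𝓝 (φ x), φ.symm u ∈ U := by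
  have : φ.target ∩ φ.symm ⁻¹' U ∈ 𝓝 (φ x) := (φ.symm.isOpen_inter_preimage hU).mem_nhds
    ⟨φ.map_source hx, by simpa [φ.left_inv hx] using hxU⟩
  filter_upwards [this] with u hu using hu.2

theorem chartDeriv_self {φ : OpenPartialHomeomorph M (Coord d)} {x : M} (hx : x ∈ φ.source) :
    chartDeriv φ φ x = ContinuousLinearMap.id ℝ _ := by
  have h3 : (φ ∘ φ.symm) =ᶠ[𝓝 (φ x)] id := by
    filter_upwards [φ.open_target.mem_nhds (φ.map_source hx)] with u hu
    simp [φ.right_inv hu]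
  rw [chartDeriv, h3.fderiv_eq, fderiv_id]

theorem map_eq_sum (L : Coord d →L[ℝ] N) (v : Coord d) : L v = ∑ b, v b • L (basisVec b) := by
  conv_lhs => rw [← (EuclideanSpace.basisFun (Fin (d+1)) ℝ).sum_repr v]
  simp [map_sum, basisVec]

variable [ChartedSpace (Coord d) M] [IsManifold (𝓡 (d + 1)) ∞ M]

theorem contDiffOn_comp_symm {φ : OpenPartialHomeomorph M (Coord d)}
    (hφ : φ ∈ atlas (Coord d) M) {f : M → N} {U : Set M}
    (hf : ContMDiffOn (𝓡 (d + 1)) 𝓘(ℝ, N) ∞ f U) :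
    ContDiffOn ℝ ∞ (f ∘ φ.symm) (φ.target ∩ φ.symm ⁻¹' U) := by
  rw [← contMDiffOn_iff_contDiffOn]
  exact hf.comp ((contMDiffOn_symm_of_mem_maximalAtlas
    (IsManifold.subset_maximalAtlas hφ)).mono inter_subset_left) inter_subset_right

theorem contMDiffOn_chartDeriv {φ : OpenPartialHomeomorph M (Coord d)}
    (hφ : φ ∈ atlas (Coord d) M) {f : M → N} {U : Set M} (hU : IsOpen U)
    (hf : ContMDiffOn (𝓡 (d + 1)) 𝓘(ℝ, N) ∞ f U) :
    ContMDiffOn (𝓡 (d + 1)) 𝓘(ℝ, Coord d →L[ℝ] N) ∞ (chartDeriv φ f) (φ.source ∩ U) := by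
  have h := (contDiffOn_comp_symm hφ hf).fderiv_of_isOpen (m := ∞)
    (φ.symm.isOpen_inter_preimage hU) (by simp)
  have h2 : ContMDiffOn (𝓡 (d + 1)) 𝓘(ℝ, Coord d) ∞ φ (φ.source ∩ U) :=
    (contMDiffOn_of_mem_maximalAtlas (IsManifold.subset_maximalAtlas hφ)).mono inter_subset_left
  refine (contMDiffOn_iff_contDiffOn.2 h).comp h2 ?_
  rintro x ⟨hx, hxU⟩
  exact ⟨φ.map_source hx, by simpa [φ.left_inv hx] using hxU⟩

theorem differentiableAt_comp_symm {φ : OpenPartialHomeomorph M (Coord d)}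
    (hφ : φ ∈ atlas (Coord d) M) {f : M → N} {U : Set M} (hU : IsOpen U)
    (hf : ContMDiffOn (𝓡 (d + 1)) 𝓘(ℝ, N) ∞ f U) {x : M} (hx : x ∈ φ.source) (hxU : x ∈ U) :
    DifferentiableAt ℝ (f ∘ φ.symm) (φ x) := by
  refine ((contDiffOn_comp_symm hφ hf).contDiffAt ?_).differentiableAt (by simp)
  exact (φ.symm.isOpen_inter_preimage hU).mem_nhds
    ⟨φ.map_source hx, by simpa [φ.left_inv hx] using hxU⟩

theorem chartDeriv_comp {φ ψ : OpenPartialHomeomorph M (Coord d)}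
    (hφ : φ ∈ atlas (Coord d) M) (hψ : ψ ∈ atlas (Coord d) M) {f : M → N} {U : Set M}
    (hU : IsOpen U) (hf : ContMDiffOn (𝓡 (d + 1)) 𝓘(ℝ, N) ∞ f U) {x : M}
    (hx : x ∈ φ.source) (hx' : x ∈ ψ.source) (hxU : x ∈ U) (v : Coord d) :
    chartDeriv ψ f x v = chartDeriv φ f x (chartDeriv ψ φ x v) := by
  have h1 : DifferentiableAt ℝ (f ∘ φ.symm) ((φ ∘ ψ.symm) (ψ x)) := by
    simpa [ψ.left_inv hx'] using differentiableAt_comp_symm hφ hU hf hx hxU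
  have h2 : DifferentiableAt ℝ (φ ∘ ψ.symm) (ψ x) :=
    differentiableAt_comp_symm hψ φ.open_source
      (contMDiffOn_of_mem_maximalAtlas (IsManifold.subset_maximalAtlas hφ)) hx' hx
  have h3 : (f ∘ ψ.symm) =ᶠ[𝓝 (ψ x)] ((f ∘ φ.symm) ∘ (φ ∘ ψ.symm)) := by
    filter_upwards [eventually_symm_mem φ.open_source hx' hx] with u hu
    simp [φ.left_inv hu]
  rw [chartDeriv, h3.fderiv_eq, fderiv_comp _ h1 h2]
  simp [chartDeriv, ψ.left_inv hx']

end charts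

/-! ### Vector bundles with a fibre structure, and their bundle of gauge fields -/

/-- A smooth complex vector bundle over `M` with a fibre structure whose automorphism group is `G`,
given by an atlas of special frames: the indices `i : ι` are the special frames, and
`coordChange i j x`, which turns components in the frame `i` into components in the frame `j`, is
smooth and has its values in `G`. For a Hermitian bundle and its orthonormal frames, `G = U(n)`. -/
structure GaugeBundle (d : ℕ) {n : ℕ} (M : Type*) [TopologicalSpace M] [ChartedSpace (Coord d) M]
    (G : Subgroup (EndFib n)ˣ) (ι : Type*) extends VectorBundleCore ℂ M (Fib n) ι where
  contMDiffOn_coordChange : ∀ i j, ContMDiffOn (𝓡 (d + 1)) 𝓘(ℝ, EndFib n) ∞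
    (coordChange i j) (baseSet i ∩ baseSet j)
  coordChange_mem : ∀ i j, ∀ x ∈ baseSet i ∩ baseSet j,
    ∃ u ∈ G, (u : EndFib n) = coordChange i j x

section bundle

variable {M : Type*} [TopologicalSpace M] [ChartedSpace (Coord d) M]

/-- The tangent space of the base manifold. -/
abbrev TBase (d : ℕ) {M : Type*} [TopologicalSpace M] [ChartedSpace (Coord d) M] (x : M) : Type :=
  TangentSpace (𝓡 (d + 1)) x

namespace GaugeBundle

variable {G : Subgroup (EndFib n)ˣ} {ι : Type*} (Z : GaugeBundle d M G ι)

/-- Indices of adapted charts: a special frame `p.1` and a chart `p.2` of the base. -/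
abbrev Index (_ : GaugeBundle d M G ι) := ι × atlas (Coord d) M

/-- The model fibre `(ℝ^m)* ⊗ 𝔤` of the bundle of gauge fields, with coordinates `y_a ∈ 𝔤`. -/
abbrev V (d : ℕ) {n : ℕ} (G : Subgroup (EndFib n)ˣ) := Fin (d + 1) → lieAlg G

/-- The transition rule for the components of linear connections from the adapted chart `p` to the
adapted chart `q`. If a linear connection has the components `κ_b` in `p`, that is
`∇_b s = ∂_b s - κ_b s`, then with `h` the change of frame its components in `q` are
`κ'_a = ∑_b (∂x^b/∂x'^a) (h κ_b h⁻¹ + (∂_b h) h⁻¹)`. -/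
noncomputable def rawChange (p q : Z.Index) (x : M) (y : V d G) (a : Fin (d + 1)) : EndFib n :=
  ∑ b, chartDeriv q.2.1 p.2.1 x (basisVec a) b •
    (Z.coordChange p.1 q.1 x * y b * Z.coordChange q.1 p.1 x +
      chartDeriv p.2.1 (Z.coordChange p.1 q.1) x (basisVec b) * Z.coordChange q.1 p.1 x)

/-- The transition rule of the bundle of gauge fields, see `rawChange` and `rawChange_mem`. -/
noncomputable def change (p q : Z.Index) (x : M) (y : V d G) : V d G :=
  fun a => toLie G (Z.rawChange p q x y a)

theorem coordChange_mul {i j k : ι} {x : M} (hx : x ∈ Z.baseSet i ∩ Z.baseSet j ∩ Z.baseSet k) :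
    Z.coordChange j k x * Z.coordChange i j x = Z.coordChange i k x := by
  ext1 v; exact Z.coordChange_comp i j k x hx v

theorem coordChange_self' {i : ι} {x : M} (hx : x ∈ Z.baseSet i) : Z.coordChange i i x = 1 := by
  ext1 v; exact Z.coordChange_self i x hx v

theorem coordChange_eq_inv {i j : ι} {x : M} (hx : x ∈ Z.baseSet i ∩ Z.baseSet j)
    {u : (EndFib n)ˣ} (hu : (u : EndFib n) = Z.coordChange i j x) :
    ((u⁻¹ : (EndFib n)ˣ) : EndFib n) = Z.coordChange j i x := by
  rw [Units.inv_eq_of_mul_eq_one_left]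
  rw [hu, Z.coordChange_mul ⟨hx, hx.1⟩, Z.coordChange_self' hx.1]

variable [IsManifold (𝓡 (d + 1)) ∞ M]

theorem chartDeriv_mul_mem {i j : ι} {φ : OpenPartialHomeomorph M (Coord d)}
    (hφ : φ ∈ atlas (Coord d) M) {x : M} (hx : x ∈ Z.baseSet i ∩ Z.baseSet j) (hxφ : x ∈ φ.source)
    (v : Coord d) :
    chartDeriv φ (Z.coordChange i j) x v * Z.coordChange j i x ∈ lieAlg G := by
  have hU := (Z.isOpen_baseSet i).inter (Z.isOpen_baseSet j)
  have hl : HasDerivAt (fun t : ℝ => φ x + t • v) v 0 := by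
    simpa using ((hasDerivAt_id (0:ℝ)).smul_const v).const_add (φ x)
  have hl0 : φ x + (0 : ℝ) • v = φ x := by simp
  refine ⟨fun t => Z.coordChange i j (φ.symm (φ x + t • v)) * Z.coordChange j i x, ?_, ?_, ?_⟩
  · have hc : Tendsto (fun t : ℝ => φ x + t • v) (𝓝 0) (𝓝 (φ x)) := by
      simpa using hl.continuousAt.tendsto
    filter_upwards [hc.eventually (eventually_symm_mem hU hxφ hx)] with t ht
    obtain ⟨u, hu, hu'⟩ := Z.coordChange_mem i j _ ht
    obtain ⟨w, hw, hw'⟩ := Z.coordChange_mem j i x ⟨hx.2, hx.1⟩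
    exact ⟨u * w, G.mul_mem hu hw, by rw [Units.val_mul, hu', hw']⟩
  · beta_reduce
    rw [hl0, φ.left_inv hxφ, Z.coordChange_mul ⟨⟨hx.2, hx.1⟩, hx.2⟩, Z.coordChange_self' hx.2]
  · have h := (differentiableAt_comp_symm hφ hU (Z.contMDiffOn_coordChange i j) hxφ hx).hasFDerivAt
    rw [← hl0] at h
    have h' := (h.comp_hasDerivAt (0:ℝ) hl).mul_const (Z.coordChange j i x)
    rw [hl0] at h'
    exact h'

theorem rawChange_mem {p q : Z.Index} {x : M}
    (hp : x ∈ Z.baseSet p.1 ∩ p.2.1.source) (hq : x ∈ Z.baseSet q.1 ∩ q.2.1.source)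
    (y : V d G) (a : Fin (d + 1)) : Z.rawChange p q x y a ∈ lieAlg G := by
  refine (lieAlg G).sum_mem fun b _ => (lieAlg G).smul_mem _ ((lieAlg G).add_mem ?_ ?_)
  · obtain ⟨u, hu, hu'⟩ := Z.coordChange_mem p.1 q.1 x ⟨hp.1, hq.1⟩
    rw [← Z.coordChange_eq_inv ⟨hp.1, hq.1⟩ hu', ← hu']
    exact conj_mem_lieAlg hu (y b).2
  · exact Z.chartDeriv_mul_mem p.2.2 ⟨hp.1, hq.1⟩ hp.2 _

theorem change_coe {p q : Z.Index} {x : M}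
    (hp : x ∈ Z.baseSet p.1 ∩ p.2.1.source) (hq : x ∈ Z.baseSet q.1 ∩ q.2.1.source)
    (y : V d G) (a : Fin (d + 1)) : (Z.change p q x y a : EndFib n) = Z.rawChange p q x y a :=
  toLie_coe (Z.rawChange_mem hp hq y a)

theorem change_self {p : Z.Index} {x : M} (hp : x ∈ Z.baseSet p.1 ∩ p.2.1.source) (y : V d G) :
    Z.change p p x y = y := by
  funext a
  apply Subtype.ext
  rw [Z.change_coe hp hp]
  have h1 : chartDeriv p.2.1 (Z.coordChange p.1 p.1) x = 0 := by
    have : (Z.coordChange p.1 p.1 ∘ p.2.1.symm) =ᶠ[𝓝 (p.2.1 x)] fun _ => 1 := by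
      filter_upwards [eventually_symm_mem (Z.isOpen_baseSet p.1) hp.2 hp.1] with u hu
      exact Z.coordChange_self' hu
    rw [chartDeriv, this.fderiv_eq, fderiv_fun_const]; rfl
  simp [rawChange, h1, chartDeriv_self hp.2, Z.coordChange_self' hp.1, basisVec, ite_smul]

theorem change_comp {p q r : Z.Index} {x : M} (hp : x ∈ Z.baseSet p.1 ∩ p.2.1.source)
    (hq : x ∈ Z.baseSet q.1 ∩ q.2.1.source) (hr : x ∈ Z.baseSet r.1 ∩ r.2.1.source) (y : V d G) :
    Z.change q r x (Z.change p q x y) = Z.change p r x y := by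
  funext c
  apply Subtype.ext
  have hop := Z.isOpen_baseSet p.1
  have hoq := Z.isOpen_baseSet q.1
  have hor := Z.isOpen_baseSet r.1
  rw [Z.change_coe hq hr, Z.change_coe hp hr, rawChange, rawChange]
  simp only [Z.change_coe hp hq]
  set h := Z.coordChange p.1 q.1 x
  set h' := Z.coordChange q.1 p.1 x
  set k := Z.coordChange q.1 r.1 x
  set k' := Z.coordChange r.1 q.1 x
  have hk : Z.coordChange p.1 r.1 x = k * h := (Z.coordChange_mul ⟨⟨hp.1, hq.1⟩, hr.1⟩).symm
  have hk' : Z.coordChange r.1 p.1 x = h' * k' := (Z.coordChange_mul ⟨⟨hr.1, hq.1⟩, hp.1⟩).symm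
  have hh : h * h' = 1 := by
    rw [Z.coordChange_mul ⟨⟨hq.1, hp.1⟩, hq.1⟩, Z.coordChange_self' hq.1]
  have hD : ∀ v, chartDeriv p.2.1 (Z.coordChange p.1 r.1) x v =
      k * chartDeriv p.2.1 (Z.coordChange p.1 q.1) x v +
        chartDeriv p.2.1 (Z.coordChange q.1 r.1) x v * h := by
    intro v
    have heq : (Z.coordChange p.1 r.1 ∘ p.2.1.symm) =ᶠ[𝓝 (p.2.1 x)]
        (Z.coordChange q.1 r.1 ∘ p.2.1.symm) * (Z.coordChange p.1 q.1 ∘ p.2.1.symm) := by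
      filter_upwards [eventually_symm_mem ((hop.inter hoq).inter hor) hp.2
        ⟨⟨hp.1, hq.1⟩, hr.1⟩] with u hu
      exact (Z.coordChange_mul hu).symm
    have d1 := differentiableAt_comp_symm p.2.2 (hoq.inter hor)
      (Z.contMDiffOn_coordChange q.1 r.1) hp.2 ⟨hq.1, hr.1⟩
    have d2 := differentiableAt_comp_symm p.2.2 (hop.inter hoq)
      (Z.contMDiffOn_coordChange p.1 q.1) hp.2 ⟨hp.1, hq.1⟩
    have := (d1.hasFDerivAt.mul' d2.hasFDerivAt).fderiv
    rw [chartDeriv, heq.fderiv_eq, this]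
    simp [chartDeriv, p.2.1.left_inv hp.2, k, h]
  have hq1 : ∀ v, chartDeriv q.2.1 (Z.coordChange q.1 r.1) x v =
      ∑ b, chartDeriv q.2.1 p.2.1 x v b • chartDeriv p.2.1 (Z.coordChange q.1 r.1) x (basisVec b) := by
    intro v
    rw [chartDeriv_comp p.2.2 q.2.2 (hoq.inter hor) (Z.contMDiffOn_coordChange q.1 r.1) hp.2 hq.2
      ⟨hq.1, hr.1⟩ v, map_eq_sum]
  have hJ : ∀ b, chartDeriv r.2.1 p.2.1 x (basisVec c) b =
      ∑ a, chartDeriv r.2.1 q.2.1 x (basisVec c) a * chartDeriv q.2.1 p.2.1 x (basisVec a) b := by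
    intro b
    rw [chartDeriv_comp q.2.2 r.2.2 p.2.1.open_source
      (contMDiffOn_of_mem_maximalAtlas (IsManifold.subset_maximalAtlas p.2.2)) hq.2 hr.2 hp.2,
      map_eq_sum]
    simp
  simp only [hJ, Finset.sum_smul, hq1, rawChange, Finset.mul_sum, Finset.sum_mul,
    ← Finset.sum_add_distrib, Finset.smul_sum]
  rw [Finset.sum_comm]
  refine Finset.sum_congr rfl fun b _ => Finset.sum_congr rfl fun a _ => ?_
  rw [hD, hk, hk', mul_smul]
  congr 1
  rw [mul_smul_comm, smul_mul_assoc, smul_mul_assoc, ← smul_add]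
  congr 1
  have e1 : chartDeriv p.2.1 (Z.coordChange q.1 r.1) x (basisVec b) * h * (h' * k') =
      chartDeriv p.2.1 (Z.coordChange q.1 r.1) x (basisVec b) * k' := by
    rw [mul_assoc, ← mul_assoc h, hh, one_mul]
  rw [add_mul _ _ (h' * k'), e1]
  simp only [mul_add, add_mul, mul_assoc, add_assoc]
  rfl


theorem contMDiffOn_change (p q : Z.Index) :
    ContMDiffOn ((𝓡 (d + 1)).prod 𝓘(ℝ, V d G)) 𝓘(ℝ, V d G) ∞
      (fun z : M × V d G => Z.change p q z.1 z.2)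
      (((Z.baseSet p.1 ∩ p.2.1.source) ∩ (Z.baseSet q.1 ∩ q.2.1.source)) ×ˢ univ) := by
  rw [contMDiffOn_pi_space]
  intro a
  apply contMDiffOn_lieAlg
  set S := ((Z.baseSet p.1 ∩ p.2.1.source) ∩ (Z.baseSet q.1 ∩ q.2.1.source))
  have hfst : ContMDiffOn ((𝓡 (d + 1)).prod 𝓘(ℝ, V d G)) (𝓡 (d + 1)) ∞
    (Prod.fst : M × V d G → M) (S ×ˢ univ) := contMDiffOn_fst
  have hS : MapsTo (Prod.fst : M × V d G → M) (S ×ˢ univ) S := fun z hz => hz.1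
  have c1 := ((Z.contMDiffOn_coordChange p.1 q.1).mono
    (s := Z.baseSet p.1 ∩ Z.baseSet q.1) (t := S) (fun x hx => ⟨hx.1.1, hx.2.1⟩)).comp hfst hS
  have c2 := ((Z.contMDiffOn_coordChange q.1 p.1).mono
    (s := Z.baseSet q.1 ∩ Z.baseSet p.1) (t := S) (fun x hx => ⟨hx.2.1, hx.1.1⟩)).comp hfst hS
  have c3 := ((contMDiffOn_chartDeriv p.2.2 ((Z.isOpen_baseSet p.1).inter (Z.isOpen_baseSet q.1))
    (Z.contMDiffOn_coordChange p.1 q.1)).mono (t := S)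
      (fun x hx => ⟨hx.1.2, hx.1.1, hx.2.1⟩)).comp hfst hS
  have c4 := ((contMDiffOn_chartDeriv q.2.2 p.2.1.open_source
    (contMDiffOn_of_mem_maximalAtlas (IsManifold.subset_maximalAtlas p.2.2))).mono (t := S)
      (fun x hx => ⟨hx.2.2, hx.1.2⟩)).comp hfst hS
  have c5 : ∀ b, ContMDiffOn ((𝓡 (d + 1)).prod 𝓘(ℝ, V d G)) 𝓘(ℝ, EndFib n) ∞
      (fun z : M × V d G => (z.2 b : EndFib n)) (S ×ˢ univ) := by
    intro b
    have : ContMDiff 𝓘(ℝ, V d G) 𝓘(ℝ, EndFib n) ∞ (fun y : V d G => (y b : EndFib n)) :=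
      ContinuousLinearMap.contMDiff ((lieAlg G).subtypeL.comp
        (ContinuousLinearMap.proj b : V d G →L[ℝ] lieAlg G) : V d G →L[ℝ] EndFib n)
    exact this.comp_contMDiffOn contMDiffOn_snd
  have mul : ∀ {f g : M × V d G → EndFib n},
      ContMDiffOn ((𝓡 (d + 1)).prod 𝓘(ℝ, V d G)) 𝓘(ℝ, EndFib n) ∞ f (S ×ˢ univ) →
      ContMDiffOn ((𝓡 (d + 1)).prod 𝓘(ℝ, V d G)) 𝓘(ℝ, EndFib n) ∞ g (S ×ˢ univ) →
      ContMDiffOn ((𝓡 (d + 1)).prod 𝓘(ℝ, V d G)) 𝓘(ℝ, EndFib n) ∞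
        (fun z => f z * g z) (S ×ˢ univ) := by
    intro f g hf hg
    have : ContDiff ℝ ∞ (fun w : EndFib n × EndFib n => w.1 * w.2) := contDiff_fst.mul contDiff_snd
    exact this.contMDiff.comp_contMDiffOn (hf.prodMk_space hg)
  have add : ∀ {f g : M × V d G → EndFib n},
      ContMDiffOn ((𝓡 (d + 1)).prod 𝓘(ℝ, V d G)) 𝓘(ℝ, EndFib n) ∞ f (S ×ˢ univ) →
      ContMDiffOn ((𝓡 (d + 1)).prod 𝓘(ℝ, V d G)) 𝓘(ℝ, EndFib n) ∞ g (S ×ˢ univ) →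
      ContMDiffOn ((𝓡 (d + 1)).prod 𝓘(ℝ, V d G)) 𝓘(ℝ, EndFib n) ∞
        (fun z => f z + g z) (S ×ˢ univ) := fun hf hg => hf.add hg
  have smul : ∀ {f : M × V d G → ℝ} {g : M × V d G → EndFib n},
      ContMDiffOn ((𝓡 (d + 1)).prod 𝓘(ℝ, V d G)) 𝓘(ℝ, ℝ) ∞ f (S ×ˢ univ) →
      ContMDiffOn ((𝓡 (d + 1)).prod 𝓘(ℝ, V d G)) 𝓘(ℝ, EndFib n) ∞ g (S ×ˢ univ) →
      ContMDiffOn ((𝓡 (d + 1)).prod 𝓘(ℝ, V d G)) 𝓘(ℝ, EndFib n) ∞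
        (fun z => f z • g z) (S ×ˢ univ) := fun hf hg => hf.smul hg
  have app : ∀ {N : Type _} [NormedAddCommGroup N] [NormedSpace ℝ N]
      {f : M × V d G → Coord d →L[ℝ] N} (v : Coord d),
      ContMDiffOn ((𝓡 (d + 1)).prod 𝓘(ℝ, V d G)) 𝓘(ℝ, Coord d →L[ℝ] N) ∞ f (S ×ˢ univ) →
      ContMDiffOn ((𝓡 (d + 1)).prod 𝓘(ℝ, V d G)) 𝓘(ℝ, N) ∞
        (fun z => f z v) (S ×ˢ univ) := by
    intro N _ _ f v hf
    exact (ContinuousLinearMap.apply ℝ N v).contMDiff.comp_contMDiffOn hf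
  have main : ContMDiffOn ((𝓡 (d + 1)).prod 𝓘(ℝ, V d G)) 𝓘(ℝ, EndFib n) ∞
      (fun z : M × V d G => Z.rawChange p q z.1 z.2 a) (S ×ˢ univ) := by
    unfold rawChange
    refine contMDiffOn_finsetSum fun b _ => ?_
    refine smul ?_ (add (mul (mul c1 (c5 b)) c2) (mul (app (basisVec b) c3) c2))
    have : ContMDiff 𝓘(ℝ, Coord d) 𝓘(ℝ, ℝ) ∞ (fun v : Coord d => v b) :=
      (EuclideanSpace.proj b : Coord d →L[ℝ] ℝ).contMDiff
    exact this.comp_contMDiffOn (app (basisVec a) c4)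
  exact main.congr fun z hz => Z.change_coe hz.1.1 hz.1.2 _ _

/-- The bundle of gauge fields, by its transition functions. -/
noncomputable def connCore : FiberBundleCore (ι × atlas (Coord d) M) M (V d G) where
  baseSet p := Z.baseSet p.1 ∩ p.2.1.source
  isOpen_baseSet p := (Z.isOpen_baseSet p.1).inter p.2.1.open_source
  indexAt x := (Z.indexAt x, achart (Coord d) x)
  mem_baseSet_at x := ⟨Z.mem_baseSet_at x, mem_chart_source (Coord d) x⟩
  coordChange := Z.change
  coordChange_self _ _ hx y := Z.change_self hx y
  continuousOn_coordChange p q := (Z.contMDiffOn_change p q).continuousOn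
  coordChange_comp _ _ _ _ hx y := Z.change_comp hx.1.1 hx.1.2 hx.2 y

/-- The bundle of gauge fields `C_G → M`: its points over `x` are the linear connections at `x`
that preserve the fibre structure. -/
abbrev ConnBundle : Type _ := Bundle.TotalSpace (V d G) Z.connCore.Fiber

theorem contDiffOn_transition (p q : Z.Index) {φ ψ : OpenPartialHomeomorph M (Coord d)}
    (hφ : φ ∈ atlas (Coord d) M) (hψ : ψ ∈ atlas (Coord d) M) :
    ContDiffOn ℝ ∞ (fun z : Coord d × V d G => (ψ (φ.symm z.1), Z.change p q (φ.symm z.1) z.2))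
      {z | z.1 ∈ φ.target ∧ φ.symm z.1 ∈ (Z.baseSet p.1 ∩ p.2.1.source) ∩
        (Z.baseSet q.1 ∩ q.2.1.source) ∧ φ.symm z.1 ∈ ψ.source} := by
  set T : Set (Coord d × V d G) := {z | z.1 ∈ φ.target ∧ φ.symm z.1 ∈
    (Z.baseSet p.1 ∩ p.2.1.source) ∩ (Z.baseSet q.1 ∩ q.2.1.source) ∧ φ.symm z.1 ∈ ψ.source}
  have hφ' : ContDiffOn ℝ ∞ (fun z : Coord d × V d G => ψ (φ.symm z.1)) T := by
    have h1 : ContDiffOn ℝ ∞ (ψ ∘ φ.symm) (φ.target ∩ φ.symm ⁻¹' ψ.source) :=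
      contDiffOn_comp_symm hφ
        (contMDiffOn_of_mem_maximalAtlas (IsManifold.subset_maximalAtlas hψ))
    exact h1.comp (f := fun z : Coord d × V d G => z.1) contDiff_fst.contDiffOn
      fun z hz => ⟨hz.1, hz.2.2⟩
  have hc : ContDiffOn ℝ ∞ (fun z : Coord d × V d G => Z.change p q (φ.symm z.1) z.2) T := by
    have h1 : ContMDiffOn ((𝓡 (d + 1)).prod 𝓘(ℝ, V d G)) ((𝓡 (d + 1)).prod 𝓘(ℝ, V d G)) ∞
        (fun z : Coord d × V d G => (φ.symm z.1, z.2)) T :=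
      ((contMDiffOn_symm_of_mem_maximalAtlas
        (IsManifold.subset_maximalAtlas hφ)).comp contMDiffOn_fst fun z hz => hz.1).prodMk
        contMDiffOn_snd
    have h2 := (Z.contMDiffOn_change p q).comp h1 fun z hz => ⟨hz.2.1, trivial⟩
    rw [← contMDiffOn_iff_contDiffOn, modelWithCornersSelf_prod, ← chartedSpaceSelf_prod]
    exact h2
  exact hφ'.prodMk hc

/-- The bundle of gauge fields is a smooth manifold. -/
instance : IsManifold ((𝓡 (d + 1)).prod 𝓘(ℝ, V d G)) ∞ Z.ConnBundle := by
  apply isManifold_of_contDiffOn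
  rintro _ _ ⟨_, ⟨_, ⟨p, rfl⟩, rfl⟩, _, ⟨φ, hφ, _, rfl, rfl⟩, rfl⟩
    ⟨_, ⟨_, ⟨q, rfl⟩, rfl⟩, _, ⟨ψ, hψ, _, rfl, rfl⟩, rfl⟩
  have key : ∀ u (y : V d G), φ.symm u ∈ Z.baseSet p.1 ∩ p.2.1.source →
      φ.symm u ∈ Z.baseSet q.1 ∩ q.2.1.source →
      Z.change (Z.connCore.indexAt (φ.symm u)) q (φ.symm u)
       (Z.change p (Z.connCore.indexAt (φ.symm u)) (φ.symm u) y) = Z.change p q (φ.symm u) y :=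
    fun u y h1 h2 => Z.change_comp h1 (Z.connCore.mem_baseSet_at _) h2 y
  have hmem : ∀ z : Coord d × V d G,
      z ∈ (((𝓡 (d + 1)).prod 𝓘(ℝ, V d G)).symm ⁻¹'
        (((Z.connCore.localTriv p).toOpenPartialHomeomorph ≫ₕ
          (φ.prod (OpenPartialHomeomorph.refl (V d G)))).symm ≫ₕ
          ((Z.connCore.localTriv q).toOpenPartialHomeomorph ≫ₕ
          (ψ.prod (OpenPartialHomeomorph.refl (V d G))))).source ∩
        range ((𝓡 (d + 1)).prod 𝓘(ℝ, V d G))) →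
      z ∈ {z | z.1 ∈ φ.target ∧ φ.symm z.1 ∈ (Z.baseSet p.1 ∩ p.2.1.source) ∩
        (Z.baseSet q.1 ∩ q.2.1.source) ∧ φ.symm z.1 ∈ ψ.source} := by
    rintro ⟨u, y⟩ ⟨hz, -⟩
    simp only [mfld_simps] at hz
    exact ⟨hz.1.1.1, ⟨hz.1.2, hz.2.1⟩, hz.2.2⟩
  refine ((Z.contDiffOn_transition p q hφ hψ).mono hmem).congr ?_
  rintro ⟨u, y⟩ hz
  obtain ⟨h1, ⟨h2, h3⟩, h4⟩ := hmem _ hz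
  exact congrArg (Prod.mk (ψ (φ.symm u))) (key u y h2 h3)



/-- The tangent space of `C_G`. -/
abbrev TConn (z : Z.ConnBundle) : Type :=
  TangentSpace ((𝓡 (d + 1)).prod 𝓘(ℝ, V d G)) z

/-- The tangent map of the projection `C_G → M`. -/
noncomputable abbrev dproj (z : Z.ConnBundle) : Z.TConn z →L[ℝ] TBase d z.proj :=
  mfderiv ((𝓡 (d + 1)).prod 𝓘(ℝ, V d G)) (𝓡 (d + 1)) (TotalSpace.proj : Z.ConnBundle → M) z

/-- The first jet bundle `J C_G → C_G`, as the subbundle of `T*M ⊗ T C_G` that projects over the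
identity of `TM`. -/
structure Jet : Type _ where
  pt : Z.ConnBundle
  lin : TBase d pt.proj →L[ℝ] Z.TConn pt
  dproj_lin : ∀ v, Z.dproj pt (lin v) = v

/-- Gauge fields: smooth sections `M → C_G`. -/
abbrev Field : Type _ := ContMDiffSection (𝓡 (d + 1)) (V d G) ∞ Z.connCore.Fiber

/-- A gauge field as a map to the total space. -/
noncomputable def Field.toMap {Z : GaugeBundle d M G ι} (κ : Z.Field) (x : M) : Z.ConnBundle := ⟨x, κ x⟩

/-- The first jet prolongation `jκ : M → J C_G`. -/
noncomputable def Field.jet {Z : GaugeBundle d M G ι} (κ : Z.Field) (x : M) : Z.Jet where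
  pt := κ.toMap x
  lin := mfderiv (𝓡 (d + 1)) ((𝓡 (d + 1)).prod 𝓘(ℝ, V d G)) κ.toMap x
  dproj_lin v := by
    have h1 : MDifferentiableAt (𝓡 (d + 1)) ((𝓡 (d + 1)).prod 𝓘(ℝ, V d G)) κ.toMap x :=
      (κ.contMDiff x).mdifferentiableAt (by simp)
    have h2 : MDifferentiableAt ((𝓡 (d + 1)).prod 𝓘(ℝ, V d G)) (𝓡 (d + 1)) (TotalSpace.proj : Z.ConnBundle → M) (κ.toMap x) :=
      (Bundle.contMDiffAt_proj (n := ∞) Z.connCore.Fiber).mdifferentiableAt (by simp)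
    have h3 := mfderiv_comp x h2 h1
    have h4 : (TotalSpace.proj : Z.ConnBundle → M) ∘ κ.toMap = id := rfl
    rw [h4, mfderiv_id] at h3
    exact (DFunLike.congr_fun h3 v).symm

/-- The fibre coordinates `y_a` of `C_G` in the adapted chart `p`. -/
noncomputable def fibCoord (p : Z.Index) (z : Z.ConnBundle) : V d G := (Z.connCore.localTriv p z).2

/-- The differentials `dy_a` of the fibre coordinates. -/
noncomputable def dy (p : Z.Index) (z : Z.ConnBundle) : Z.TConn z →L[ℝ] V d G :=
  mfderiv ((𝓡 (d + 1)).prod 𝓘(ℝ, V d G)) 𝓘(ℝ, V d G) (Z.fibCoord p) z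

end GaugeBundle

/-! ### The metric background -/

/-- The differentials `dx^a` of the coordinates of `φ`, as a map `T_xM → ℝ^m`. -/
noncomputable def dx (φ : OpenPartialHomeomorph M (Coord d)) (x : M) : TBase d x →L[ℝ] Coord d :=
  mfderiv (𝓡 (d + 1)) 𝓘(ℝ, Coord d) φ x

/-- The coordinate vectors `∂x_a`. -/
noncomputable def del (φ : OpenPartialHomeomorph M (Coord d)) (x : M) (a : Fin (d + 1)) :
    TBase d x :=
  (dx φ x).inverse (basisVec a)

/-- `d^m x = dx^1 ∧ ⋯ ∧ dx^m`. -/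
noncomputable def dVol (φ : OpenPartialHomeomorph M (Coord d)) (x : M) :
    TBase d x [⋀^Fin (d + 1)]→ₗ[ℝ] ℝ :=
  (EuclideanSpace.basisFun (Fin (d + 1)) ℝ).toBasis.det.compLinearMap (dx φ x).toLinearMap

/-- `dx_a`, the interior product of `∂x_a` with `d^m x`. -/
noncomputable def dxHat (φ : OpenPartialHomeomorph M (Coord d)) (x : M) (a : Fin (d + 1)) :
    TBase d x [⋀^Fin d]→ₗ[ℝ] ℝ :=
  (dVol φ x).curryLeft (del φ x a)

/-- An oriented manifold with a smooth nondegenerate metric (of any signature, in particular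
Lorentzian). The orientation is given by the atlas, whose charts are the positively oriented ones. -/
structure Background (d : ℕ) (M : Type*) [TopologicalSpace M] [ChartedSpace (Coord d) M]
    [IsManifold (𝓡 (d + 1)) ∞ M] where
  g : ∀ x : M, TBase d x →L[ℝ] TBase d x →L[ℝ] ℝ
  symm : ∀ x v w, g x v w = g x w v
  nondegenerate : ∀ x v, (∀ w, g x v w = 0) → v = 0
  contMDiff : ContMDiff (𝓡 (d + 1)) ((𝓡 (d + 1)).prod 𝓘(ℝ, Coord d →L[ℝ] Coord d →L[ℝ] ℝ)) ∞
    (fun x => TotalSpace.mk' (Coord d →L[ℝ] Coord d →L[ℝ] ℝ)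
      (E := fun x : M => TBase d x →L[ℝ] TBase d x →L[ℝ] ℝ) x (g x))
  oriented : ∀ φ ∈ atlas (Coord d) M, ∀ ψ ∈ atlas (Coord d) M, ∀ x ∈ φ.source ∩ ψ.source,
    0 < (chartDeriv φ ψ x).det

variable [IsManifold (𝓡 (d + 1)) ∞ M] (S : Background d M)

namespace Background

/-- The components `g_ab`. -/
noncomputable def gram (φ : OpenPartialHomeomorph M (Coord d)) (x : M) :
    Matrix (Fin (d + 1)) (Fin (d + 1)) ℝ :=
  Matrix.of fun a b => S.g x (del φ x a) (del φ x b)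

/-- The partial derivatives `∂_c g_ab`. -/
noncomputable def dgram (φ : OpenPartialHomeomorph M (Coord d)) (x : M) (c a b : Fin (d + 1)) : ℝ :=
  chartDeriv φ (fun x' => S.gram φ x' a b) x (basisVec c)

/-- The coefficients `Γ_a^c_b` of the Levi-Civita connection, with the sign convention
`∇_a v^c = ∂_a v^c - Γ_a^c_b v^b` (they are minus the usual Christoffel symbols). -/
noncomputable def leviCivita (φ : OpenPartialHomeomorph M (Coord d)) (x : M)
    (a c b : Fin (d + 1)) : ℝ :=
  -(1 / 2) * ∑ f, (S.gram φ x)⁻¹ c f * (S.dgram φ x a f b + S.dgram φ x b f a - S.dgram φ x f a b)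

end Background

/-! ### The Yang–Mills Lagrangian

Points of `J C_G` have, in an adapted chart, the fibre coordinates `y_a` and `y_{c,b}`; the latter
are written `s b c`. -/

section coordinates

variable {G : Subgroup (EndFib n)ˣ}

/-- The curvature `ρ_ab = y_{a,b} - y_{b,a} + [y_a, y_b]`, as a function on the jet bundle. -/
noncomputable def curv (y : Fin (d + 1) → lieAlg G) (s : Fin (d + 1) → Fin (d + 1) → lieAlg G)
    (a b : Fin (d + 1)) : lieAlg G :=
  s b a - s a b + brk (y a) (y b)

/-- The coefficient `ℓ = -(1/4) g^{ac} g^{bf} ⟨ρ_ab, ρ_cf⟩ √|g|` of the Lagrangian. -/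
noncomputable def ell (φ : OpenPartialHomeomorph M (Coord d)) (x : M)
    (y : Fin (d + 1) → lieAlg G) (s : Fin (d + 1) → Fin (d + 1) → lieAlg G) : ℝ :=
  -(1 / 4) * (∑ a, ∑ b, ∑ c, ∑ f, (S.gram φ x)⁻¹ a c * (S.gram φ x)⁻¹ b f *
    pairing (curv y s a b) (curv y s c f)) * √|(S.gram φ x).det|

/-- The momentum `P^a^c = ∂ℓ/∂y_{c,a}`, with values in the dual of `𝔤`. -/
noncomputable def momentum (φ : OpenPartialHomeomorph M (Coord d)) (x : M)
    (y : Fin (d + 1) → lieAlg G) (s : Fin (d + 1) → Fin (d + 1) → lieAlg G)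
    (a c : Fin (d + 1)) : lieAlg G →ₗ[ℝ] ℝ :=
  (fderiv ℝ (ell S φ x y) s).toLinearMap ∘ₗ
    LinearMap.single ℝ (fun _ : Fin (d + 1) => Fin (d + 1) → lieAlg G) a ∘ₗ
    LinearMap.single ℝ (fun _ : Fin (d + 1) => lieAlg G) c

/-- The components at the point `y` of the overconnection determined by a gauge field and the
Levi-Civita connection,
`(κ↑_a)_b = ∂_b κ_a + [κ_a, y_b] + Γ_a^c_b (κ_c - y_c)`;
here `k a = κ_a` and `dk b a = ∂_b κ_a` are the components of the field and their derivatives. -/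
noncomputable def overComp (φ : OpenPartialHomeomorph M (Coord d)) (x : M)
    (k : Fin (d + 1) → lieAlg G) (dk : Fin (d + 1) → Fin (d + 1) → lieAlg G)
    (y : Fin (d + 1) → lieAlg G) (a : Fin (d + 1)) : Fin (d + 1) → lieAlg G :=
  fun b => dk b a + brk (k a) (y b) + ∑ c, S.leviCivita φ x a c b • (k c - y c)

/-- The linear map `v ↦ ∑_a v^a s_a`. -/
noncomputable def alongCoord (s : Fin (d + 1) → Fin (d + 1) → lieAlg G) :
    Coord d →L[ℝ] (Fin (d + 1) → lieAlg G) :=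
  ∑ a, (EuclideanSpace.proj a : Coord d →L[ℝ] ℝ).smulRight (s a)

end coordinates

namespace GaugeBundle

variable {G : Subgroup (EndFib n)ˣ} {ι : Type*} {Z : GaugeBundle d M G ι}

/-- The coordinates `y_a` of a jet. -/
noncomputable def Jet.y (j : Z.Jet) (p : Z.Index) : V d G := Z.fibCoord p j.pt

/-- The coordinates `y_{c,b} = j.s p b c` of a jet. -/
noncomputable def Jet.s (j : Z.Jet) (p : Z.Index) (b : Fin (d + 1)) : V d G :=
  Z.dy p j.pt (j.lin (del p.2.1 j.pt.proj b))

/-! ### The overconnection and horizontal lifts -/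

/-- The overconnection `κ↑` of a gauge field `κ`, as the tangent-valued form
`dx^a ⊗ (∂x_a + (κ↑_a)_b ∂y^b)` on `C_G`, in the adapted chart `p`. -/
noncomputable def overconnection (p : Z.Index) (κ : Z.Field) (z : Z.ConnBundle) :
    TBase d z.proj →L[ℝ] Z.TConn z :=
  (((dx p.2.1 z.proj).comp (Z.dproj z)).prod (Z.dy p z)).inverse.comp
    (((ContinuousLinearMap.id ℝ (Coord d)).prod (alongCoord
      (overComp S p.2.1 z.proj ((κ.jet z.proj).y p) ((κ.jet z.proj).s p) (Z.fibCoord p z)))).comp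
        (dx p.2.1 z.proj))

/-- The horizontal lift `Y = X ⌋ κ↑` of a vector field `X` on `M`, a vector field on `C_G`. -/
noncomputable def horLift (p : Z.Index) (κ : Z.Field) (X : ∀ x : M, TBase d x)
    (z : Z.ConnBundle) : Z.TConn z :=
  overconnection S p κ z (X z.proj)

/-! ### Forms on the jet bundle

The forms considered here are morphisms `J C_G → Λ^k T* C_G` over `C_G`, which the inclusion
`T* C_G ⊆ T* J C_G` makes into forms on `J C_G`. Their interior product with a vector field on
`J C_G` depends only on the projection of this vector field to `T C_G`, and their pull-back by `jκ`
at `x` is the pull-back of their value at `jκ(x)` by the tangent map of `κ`. -/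

/-- Horizontal `k`-forms over `C_G` on `J C_G`. -/
abbrev SemibasicForm (Z : GaugeBundle d M G ι) (k : ℕ) : Type _ :=
  ∀ j : Z.Jet, Z.TConn j.pt [⋀^Fin k]→ₗ[ℝ] ℝ

/-- The interior product with a vector field of `C_G`. -/
noncomputable def interior {k : ℕ} (Y : ∀ z : Z.ConnBundle, Z.TConn z)
    (β : SemibasicForm Z (k + 1)) : SemibasicForm Z k :=
  fun j => (β j).curryLeft (Y j.pt)

/-- The pull-back `jκ*β`, a form on `M`. -/
noncomputable def Field.pullback {k : ℕ} (κ : Z.Field) (β : SemibasicForm Z k) (x : M) :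
    TBase d x [⋀^Fin k]→ₗ[ℝ] ℝ :=
  (β (κ.jet x)).compLinearMap
    (mfderiv (𝓡 (d + 1)) ((𝓡 (d + 1)).prod 𝓘(ℝ, V d G)) κ.toMap x).toLinearMap

/-- The contact form `ϑ_c = dy_c - y_{c,b} dx^b`. -/
noncomputable def Jet.contact (j : Z.Jet) (p : Z.Index) : Z.TConn j.pt →L[ℝ] V d G :=
  Z.dy p j.pt - (alongCoord (j.s p)).comp ((dx p.2.1 j.pt.proj).comp (Z.dproj j.pt))

/-- The Lagrangian form `ℓ d^m x`. -/
noncomputable def lagrangian (p : Z.Index) : SemibasicForm Z (d + 1) := fun j =>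
  ell S p.2.1 j.pt.proj (j.y p) (j.s p) •
    (dVol p.2.1 j.pt.proj).compLinearMap (Z.dproj j.pt).toLinearMap

/-- The momentum form `P^a^c ϑ_c ∧ dx_a`. (The operation `alternatizeUncurryFin` takes `θ ⊗ β`, with
`θ` a 1-form, to `θ ∧ β`.) -/
noncomputable def momentumForm (p : Z.Index) : SemibasicForm Z (d + 1) := fun j =>
  AlternatingMap.alternatizeUncurryFin (∑ a, ∑ c,
    (momentum S p.2.1 j.pt.proj (j.y p) (j.s p) a c ∘ₗ LinearMap.proj c ∘ₗ
      (j.contact p).toLinearMap).smulRight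
      ((dxHat p.2.1 j.pt.proj a).compLinearMap (Z.dproj j.pt).toLinearMap))

/-- The gauge Poincaré–Cartan form. -/
noncomputable def poincareCartan (p : Z.Index) : SemibasicForm Z (d + 1) :=
  lagrangian S p + momentumForm S p

/-! ### The canonical energy-tensor -/

/-- The covariant derivative with respect to `κ↑` of a gauge field `κ` itself, as a function of the
jet of `κ`: `∇_b κ_c = ∂_b κ_c - (κ↑_b)_c ∘ κ`. -/
noncomputable def Jet.nabla (j : Z.Jet) (p : Z.Index) (b : Fin (d + 1)) : V d G :=
  j.s p b - overComp S p.2.1 j.pt.proj (j.y p) (j.s p) (j.y p) b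

/-- The gauge canonical energy-tensor `(ℓ δ^a_b - P^a^c ∇_b κ_c) dx_a ⊗ dx^b`, as a morphism
`J C_G → Λ^{m-1} T*M ⊗ T*M`; its contraction with a vector is its value at this vector. -/
noncomputable def energyTensor (p : Z.Index) (j : Z.Jet) :
    TBase d j.pt.proj →ₗ[ℝ] TBase d j.pt.proj [⋀^Fin d]→ₗ[ℝ] ℝ :=
  ∑ a, ∑ b, ((if a = b then ell S p.2.1 j.pt.proj (j.y p) (j.s p) else 0) -
      ∑ c, momentum S p.2.1 j.pt.proj (j.y p) (j.s p) a c (j.nabla S p b c)) •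
    ((EuclideanSpace.proj b).comp (dx p.2.1 j.pt.proj)).toLinearMap.smulRight
      (dxHat p.2.1 j.pt.proj a)

end GaugeBundle

end bundle

end YangMills

open YangMills

namespace YangMills

variable {n d : ℕ} {M : Type*} [TopologicalSpace M] [ChartedSpace (Coord d) M]
  [IsManifold (𝓡 (d + 1)) ∞ M]

/-! The identity is pointwise and linear-algebraic. Fix `x`, let `j` be the jet of `κ` at `x` and
`Y` the horizontal lift at `κ(x)`. The pull-back inserts in the Poincaré–Cartan form, after `Y`,
only vectors `j.lin v` tangent to the image of `κ`. The contact forms `ϑ_c` vanish on these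
(`Jet.contact_lin`), so `i_Y (ϑ_c ∧ dx_a)` reduces to `ϑ_c(Y) dx_a`. The Lagrangian part comes from
the base and gives `ℓ X^a dx_a`, since `Y` projects to `X`.

It remains to find `ϑ_c(Y)`. The `dy_c`-component of `Y` is `X^b (κ↑_b)_c`, taken at the point
`κ(x)`, and `ϑ_c` subtracts `X^b ∂_b κ_c`. The difference is `-X^b ∇_b κ_c`
(`Jet.contact_eq_neg_nabla`), which is the second term of the energy-tensor.

The particular form of `ℓ`, of the momentum and of the overconnection plays no role: `P^a^c` enters
only as a linear coefficient, and the same overconnection defines both `Y` and `∇κ`.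

The analytic content is that `(dx^a, dy_a)` is an isomorphism on each tangent space of `C_G`
(`coordDifferential_isInvertible`). The horizontal lift is defined through the inverse of this map,
and its components can be read off only once invertibility is known. -/

theorem alongCoord_apply {G : Subgroup (EndFib n)ˣ} (s : Fin (d + 1) → Fin (d + 1) → lieAlg G)
    (v : Coord d) : alongCoord s v = ∑ a, v a • s a := by
  simp [alongCoord]

/-! ### Coordinate differentials and coordinate vectors on the base. -/

theorem mdifferentiable_of_mem_atlas_infty {φ : OpenPartialHomeomorph M (Coord d)}
    (hφ : φ ∈ atlas (Coord d) M) : φ.MDifferentiable (𝓡 (d + 1)) (𝓡 (d + 1)) :=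
  haveI : IsManifold (𝓡 (d + 1)) 1 M := IsManifold.of_le (n := ∞) (by simp)
  mdifferentiable_of_mem_atlas hφ

/-- A chart of the atlas is a diffeomorphism onto its image. This is needed because `del` uses
`ContinuousLinearMap.inverse`, whose value on a non-invertible map is zero by convention. -/
theorem dx_isInvertible {φ : OpenPartialHomeomorph M (Coord d)}
    (hφ : φ ∈ atlas (Coord d) M) {x : M} (hx : x ∈ φ.source) : (dx φ x).IsInvertible :=
  ⟨(mdifferentiable_of_mem_atlas_infty hφ).mfderiv hx, rfl⟩

theorem dx_del {φ : OpenPartialHomeomorph M (Coord d)}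
    (hφ : φ ∈ atlas (Coord d) M) {x : M} (hx : x ∈ φ.source) (a : Fin (d + 1)) :
    dx φ x (del φ x a) = basisVec a :=
  (((dx_isInvertible hφ hx).inverse_apply_eq).1 rfl).symm

/-- A tangent vector is the combination of the coordinate vectors given by its components. -/
theorem sum_dx_smul_del {φ : OpenPartialHomeomorph M (Coord d)}
    (hφ : φ ∈ atlas (Coord d) M) {x : M} (hx : x ∈ φ.source) (v : TBase d x) :
    ∑ a, dx φ x v a • del φ x a = v := by
  refine (dx_isInvertible hφ hx).injective ?_
  rw [map_sum]
  simp only [map_smul, dx_del hφ hx]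
  exact (map_eq_sum (ContinuousLinearMap.id ℝ (Coord d)) (dx φ x v)).symm

/-- Linearity of the interior product in the vector, after expansion in the `∂x_a`. This is the
source of the `ℓ δ^a_b` term of the energy-tensor. -/
theorem dVol_curryLeft {φ : OpenPartialHomeomorph M (Coord d)}
    (hφ : φ ∈ atlas (Coord d) M) {x : M} (hx : x ∈ φ.source) (v : TBase d x) :
    (dVol φ x).curryLeft v = ∑ a, dx φ x v a • dxHat φ x a := by
  conv_lhs => rw [← sum_dx_smul_del hφ hx v]
  simp [dxHat, map_sum]

/-! ### Adapted charts of the bundle of gauge fields. -/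

namespace GaugeBundle

variable {G : Subgroup (EndFib n)ˣ} {ι : Type*} (Z : GaugeBundle d M G ι)

/-- The coordinates `(x^a, y_a)` of an adapted chart, as a chart of `C_G`. -/
noncomputable def adaptedChart (p : Z.Index) :
    OpenPartialHomeomorph Z.ConnBundle (ModelProd (Coord d) (V d G)) :=
  (Z.connCore.localTriv p).toOpenPartialHomeomorph ≫ₕ
    p.2.1.prod (OpenPartialHomeomorph.refl (V d G))

/-- The atlas of the total space consists of the trivializations followed by product charts, so
membership holds by construction. With the smooth manifold structure of `C_G` it makes the adapted
chart a diffeomorphism onto its image. -/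
theorem adaptedChart_mem_atlas (p : Z.Index) :
    Z.adaptedChart p ∈ atlas (ModelProd (Coord d) (V d G)) Z.ConnBundle :=
  ⟨_, ⟨_, ⟨p, rfl⟩, rfl⟩, _, ⟨p.2.1, p.2.2, _, rfl, rfl⟩, rfl⟩

theorem mem_adaptedChart_source {p : Z.Index} {z : Z.ConnBundle}
    (hz : z.proj ∈ Z.connCore.baseSet p) : z ∈ (Z.adaptedChart p).source := by
  have h : z.proj ∈ Z.baseSet p.1 ∩ p.2.1.source := hz
  simp only [adaptedChart, mfld_simps]
  exact ⟨hz, h.2⟩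

theorem adaptedChart_mdifferentiable (p : Z.Index) :
    (Z.adaptedChart p).MDifferentiable ((𝓡 (d + 1)).prod 𝓘(ℝ, V d G))
      ((𝓡 (d + 1)).prod 𝓘(ℝ, V d G)) :=
  haveI : IsManifold ((𝓡 (d + 1)).prod 𝓘(ℝ, V d G)) 1 Z.ConnBundle :=
    IsManifold.of_le (n := ∞) (by simp)
  mdifferentiable_of_mem_atlas (Z.adaptedChart_mem_atlas p)

theorem adaptedChart_mdifferentiableAt {p : Z.Index} {z : Z.ConnBundle}
    (hz : z.proj ∈ Z.connCore.baseSet p) :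
    MDifferentiableAt ((𝓡 (d + 1)).prod 𝓘(ℝ, V d G)) 𝓘(ℝ, Coord d × V d G)
      (fun z' => (p.2.1 z'.proj, Z.fibCoord p z')) z := by
  have := (Z.adaptedChart_mdifferentiable p).mdifferentiableAt (Z.mem_adaptedChart_source hz)
  rw [modelWithCornersSelf_prod]
  exact this

theorem fibCoord_mdifferentiableAt {p : Z.Index} {z : Z.ConnBundle}
    (hz : z.proj ∈ Z.connCore.baseSet p) :
    MDifferentiableAt ((𝓡 (d + 1)).prod 𝓘(ℝ, V d G)) 𝓘(ℝ, V d G) (Z.fibCoord p) z :=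
  (ContinuousLinearMap.snd ℝ (Coord d) (V d G)).mdifferentiableAt.comp z
    (Z.adaptedChart_mdifferentiableAt hz)

theorem proj_mdifferentiableAt (z : Z.ConnBundle) :
    MDifferentiableAt ((𝓡 (d + 1)).prod 𝓘(ℝ, V d G)) (𝓡 (d + 1))
      (TotalSpace.proj : Z.ConnBundle → M) z :=
  (Bundle.contMDiffAt_proj (n := ∞) Z.connCore.Fiber).mdifferentiableAt (by simp)

/-- The base coordinates on `C_G` are `x^a ∘ proj`, so the chain rule gives the first component; the
second is `dy` by definition. This transfers invertibility from the chart to the pair used in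
`overconnection`. -/
theorem mfderiv_adaptedChart {p : Z.Index} {z : Z.ConnBundle}
    (hz : z.proj ∈ Z.connCore.baseSet p) :
    mfderiv ((𝓡 (d + 1)).prod 𝓘(ℝ, V d G)) ((𝓡 (d + 1)).prod 𝓘(ℝ, V d G)) (Z.adaptedChart p) z =
      ((dx p.2.1 z.proj).comp (Z.dproj z)).prod (Z.dy p z) := by
  have h1 : HasMFDerivAt (𝓡 (d + 1)) 𝓘(ℝ, Coord d) p.2.1 z.proj (dx p.2.1 z.proj) :=
    ((mdifferentiable_of_mem_atlas_infty p.2.2).mdifferentiableAt hz.2).hasMFDerivAt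
  have h2 := h1.comp z (Z.proj_mdifferentiableAt z).hasMFDerivAt
  have h3 := HasMFDerivAt.prodMk h2 (Z.fibCoord_mdifferentiableAt hz).hasMFDerivAt
  -- The pair of derivatives lands in a product of model spaces, while the chart has one model space
  -- as target; this identifies the two charted-space structures.
  rw [chartedSpaceSelf_prod] at h3
  exact HasMFDerivAt.mfderiv h3

theorem coordDifferential_isInvertible {p : Z.Index} {z : Z.ConnBundle}
    (hz : z.proj ∈ Z.connCore.baseSet p) :
    (((dx p.2.1 z.proj).comp (Z.dproj z)).prod (Z.dy p z)).IsInvertible := by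
  rw [← Z.mfderiv_adaptedChart hz]
  exact ⟨(Z.adaptedChart_mdifferentiable p).mfderiv (Z.mem_adaptedChart_source hz), rfl⟩

variable {Z}

/-! ### Components of the horizontal lift. -/

section lifts

variable (S : Background d M) {p : Z.Index} (κ : Z.Field) (X : ∀ x : M, TBase d x)
  {z : Z.ConnBundle}

theorem coordDifferential_horLift (hz : z.proj ∈ Z.connCore.baseSet p) :
    (dx p.2.1 z.proj (Z.dproj z (horLift S p κ X z)), Z.dy p z (horLift S p κ X z)) =
      (dx p.2.1 z.proj (X z.proj), alongCoord (overComp S p.2.1 z.proj ((κ.jet z.proj).y p)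
        ((κ.jet z.proj).s p) (Z.fibCoord p z)) (dx p.2.1 z.proj (X z.proj))) :=
  -- By definition the lift is the inverse coordinate differential applied to the right-hand side;
  -- invertibility makes that inverse a genuine one.
  (((Z.coordDifferential_isInvertible hz).inverse_apply_eq).1 rfl).symm

/-- The `dx`-part of the overconnection is the identity, and `dx` is injective on the base. -/
theorem dproj_horLift (hz : z.proj ∈ Z.connCore.baseSet p) :
    Z.dproj z (horLift S p κ X z) = X z.proj :=
  (dx_isInvertible p.2.2 hz.2).injective (congrArg Prod.fst (coordDifferential_horLift S κ X hz))

theorem dy_horLift (hz : z.proj ∈ Z.connCore.baseSet p) :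
    Z.dy p z (horLift S p κ X z) =
      alongCoord (overComp S p.2.1 z.proj ((κ.jet z.proj).y p) ((κ.jet z.proj).s p)
        (Z.fibCoord p z)) (dx p.2.1 z.proj (X z.proj)) :=
  congrArg Prod.snd (coordDifferential_horLift S κ X hz)

end lifts

/-! ### The contact form on jet vectors and on horizontal vectors. -/

/-- The contact form vanishes on the vectors of the jet. -/
theorem Jet.contact_lin (j : Z.Jet) {p : Z.Index} (hj : j.pt.proj ∈ Z.connCore.baseSet p)
    (v : TBase d j.pt.proj) : j.contact p (j.lin v) = 0 := by
  have h : j.contact p (j.lin v) = Z.dy p j.pt (j.lin v) -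
      alongCoord (j.s p) (dx p.2.1 j.pt.proj (Z.dproj j.pt (j.lin v))) := rfl
  rw [h, j.dproj_lin, alongCoord_apply, sub_eq_zero]
  -- The jet coordinates `y_{c,b}` are by definition the values of `dy_c` on `j.lin (∂x_b)`, so
  -- expanding `v` in the `∂x_b` makes both terms agree.
  conv_lhs => rw [← sum_dx_smul_del p.2.2 hj.2 v]
  simp only [map_sum, map_smul]
  rfl

/-- On a vector which is horizontal for the overconnection determined by `j`, the contact form is
minus the covariant derivative. -/
theorem Jet.contact_eq_neg_nabla (S : Background d M) (j : Z.Jet) {p : Z.Index} (Y : Z.TConn j.pt)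
    (hY : Z.dy p j.pt Y = alongCoord (overComp S p.2.1 j.pt.proj (j.y p) (j.s p) (j.y p))
      (dx p.2.1 j.pt.proj (Z.dproj j.pt Y))) (c : Fin (d + 1)) :
    j.contact p Y c = -∑ b, dx p.2.1 j.pt.proj (Z.dproj j.pt Y) b • j.nabla S p b c := by
  have h : j.contact p Y = Z.dy p j.pt Y -
      alongCoord (j.s p) (dx p.2.1 j.pt.proj (Z.dproj j.pt Y)) := rfl
  rw [h, hY, alongCoord_apply, alongCoord_apply, Pi.sub_apply, Finset.sum_apply, Finset.sum_apply,
    ← Finset.sum_sub_distrib, ← Finset.sum_neg_distrib]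
  refine Finset.sum_congr rfl fun b _ => ?_
  -- Here `A` is the component of the overconnection and `B` that of the jet, so `B - A` unfolds to
  -- `nabla`; the reversed order produces the minus sign.
  have key : ∀ (r : ℝ) (A B : lieAlg G), r • A - r • B = -(r • (B - A)) := fun r A B => by
    rw [smul_sub, neg_sub]
  exact key _ _ _

/-! ### Multilinear algebra of the contraction. -/

theorem alternatingMap_sum_apply {E α κ : Type*} [AddCommGroup E] [Module ℝ E] (s : Finset α)
    (f : α → E [⋀^κ]→ₗ[ℝ] ℝ) (v : κ → E) : (∑ a ∈ s, f a) v = ∑ a ∈ s, f a v := by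
  classical
  induction s using Finset.induction_on with
  | empty => simp
  | insert a s ha ih => rw [Finset.sum_insert ha, Finset.sum_insert ha, AlternatingMap.add_apply, ih]

/-- The interior product with `y` of `θ ∧ β`, restricted to vectors on which `θ` vanishes. -/
theorem alternatizeUncurryFin_vecCons {E : Type*} [AddCommGroup E] [Module ℝ E] {k : ℕ}
    (f : E →ₗ[ℝ] E [⋀^Fin k]→ₗ[ℝ] ℝ) (y : E) (v : Fin k → E) (hv : ∀ i, f (v i) = 0) :
    AlternatingMap.alternatizeUncurryFin f (Matrix.vecCons y v) = f y v := by
  -- The alternating sum runs over which argument is fed to `f`. Only index `0`, where `f` receives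
  -- `y`, survives `hv`, and its sign is `+1`.
  rw [AlternatingMap.alternatizeUncurryFin_apply, Fin.sum_univ_succ]
  simp only [Matrix.cons_val_succ, hv]
  simp [Fin.removeNth_zero, Matrix.vecCons]

/-! ### Contraction of the Poincaré–Cartan form at a jet. -/

section contraction

variable (S : Background d M) (j : Z.Jet) {p : Z.Index}

/-- The Lagrangian form is pulled back from the base, so only the projections of its arguments
matter, and `j.lin` is a section of the projection. -/
theorem lagrangian_vecCons_lin (hj : j.pt.proj ∈ Z.connCore.baseSet p) (Y : Z.TConn j.pt)
    (v : Fin d → TBase d j.pt.proj) :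
    lagrangian S p j (Matrix.vecCons Y fun i => j.lin (v i)) =
      ∑ a, dx p.2.1 j.pt.proj (Z.dproj j.pt Y) a *
        (ell S p.2.1 j.pt.proj (j.y p) (j.s p) * dxHat p.2.1 j.pt.proj a v) := by
  have h1 : lagrangian S p j (Matrix.vecCons Y fun i => j.lin (v i)) =
      ell S p.2.1 j.pt.proj (j.y p) (j.s p) * dVol p.2.1 j.pt.proj
        (fun i => Z.dproj j.pt (Matrix.vecCons Y (fun i => j.lin (v i)) i)) := rfl
  have h2 : (fun i => Z.dproj j.pt (Matrix.vecCons Y (fun i => j.lin (v i)) i)) =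
      Matrix.vecCons (Z.dproj j.pt Y) v := by
    funext i
    refine Fin.cases rfl (fun i => ?_) i
    exact j.dproj_lin (v i)
  have h3 := congrArg (fun f => f v) (dVol_curryLeft p.2.2 hj.2 (Z.dproj j.pt Y))
  simp only [AlternatingMap.curryLeft_apply_apply, alternatingMap_sum_apply,
    AlternatingMap.smul_apply, smul_eq_mul] at h3
  rw [h1, h2, h3, Finset.mul_sum]
  exact Finset.sum_congr rfl fun a _ => by ring

/-- All arguments but `Y` are annihilated by the contact form, so each wedge product contributes
only the term in which the contact form takes `Y`; the factor `dx_a` then sees only the projections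
`v i`. -/
theorem momentumForm_vecCons_lin (hj : j.pt.proj ∈ Z.connCore.baseSet p) (Y : Z.TConn j.pt)
    (v : Fin d → TBase d j.pt.proj) :
    momentumForm S p j (Matrix.vecCons Y fun i => j.lin (v i)) =
      ∑ a, ∑ c, momentum S p.2.1 j.pt.proj (j.y p) (j.s p) a c (j.contact p Y c) *
        dxHat p.2.1 j.pt.proj a v := by
  have hf : ∀ W : Z.TConn j.pt, (∑ a, ∑ c,
      (momentum S p.2.1 j.pt.proj (j.y p) (j.s p) a c ∘ₗ LinearMap.proj c ∘ₗ
        (j.contact p).toLinearMap).smulRight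
        ((dxHat p.2.1 j.pt.proj a).compLinearMap (Z.dproj j.pt).toLinearMap)) W =
      ∑ a, ∑ c, momentum S p.2.1 j.pt.proj (j.y p) (j.s p) a c (j.contact p W c) •
        (dxHat p.2.1 j.pt.proj a).compLinearMap (Z.dproj j.pt).toLinearMap := by
    intro W
    rw [LinearMap.sum_apply]
    refine Finset.sum_congr rfl fun a _ => ?_
    rw [LinearMap.sum_apply]
    rfl
  rw [momentumForm, alternatizeUncurryFin_vecCons, hf]
  · rw [alternatingMap_sum_apply]
    refine Finset.sum_congr rfl fun a _ => ?_
    rw [alternatingMap_sum_apply]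
    refine Finset.sum_congr rfl fun c _ => ?_
    rw [AlternatingMap.smul_apply, AlternatingMap.compLinearMap_apply, smul_eq_mul]
    congr 2
    exact funext fun i => j.dproj_lin (v i)
  · intro i
    rw [hf, j.contact_lin hj]
    exact Finset.sum_eq_zero fun a _ => Finset.sum_eq_zero fun c _ => by
      rw [Pi.zero_apply, map_zero, zero_smul]

theorem energyTensor_apply (w : TBase d j.pt.proj) (v : Fin d → TBase d j.pt.proj) :
    energyTensor S p j w v = ∑ a, ∑ b,
      ((if a = b then ell S p.2.1 j.pt.proj (j.y p) (j.s p) else 0) -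
        ∑ c, momentum S p.2.1 j.pt.proj (j.y p) (j.s p) a c (j.nabla S p b c)) *
      (dx p.2.1 j.pt.proj w b * dxHat p.2.1 j.pt.proj a v) := by
  rw [energyTensor, LinearMap.sum_apply, alternatingMap_sum_apply]
  refine Finset.sum_congr rfl fun a _ => ?_
  rw [LinearMap.sum_apply, alternatingMap_sum_apply]
  rfl

/-- The contraction of the energy-tensor with the projection of a horizontal vector is the
contraction of the Poincaré–Cartan form with this vector, pulled back by the jet. -/
theorem energyTensor_eq_poincareCartan (hj : j.pt.proj ∈ Z.connCore.baseSet p)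
    (Y : Z.TConn j.pt)
    (hY : Z.dy p j.pt Y = alongCoord (overComp S p.2.1 j.pt.proj (j.y p) (j.s p) (j.y p))
      (dx p.2.1 j.pt.proj (Z.dproj j.pt Y))) (v : Fin d → TBase d j.pt.proj) :
    energyTensor S p j (Z.dproj j.pt Y) v =
      poincareCartan S p j (Matrix.vecCons Y fun i => j.lin (v i)) := by
  have h : poincareCartan S p j (Matrix.vecCons Y fun i => j.lin (v i)) =
      lagrangian S p j (Matrix.vecCons Y fun i => j.lin (v i)) +
        momentumForm S p j (Matrix.vecCons Y fun i => j.lin (v i)) := rfl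
  rw [h, lagrangian_vecCons_lin S j hj, momentumForm_vecCons_lin S j hj, energyTensor_apply,
    ← Finset.sum_add_distrib]
  refine Finset.sum_congr rfl fun a _ => ?_
  -- For fixed `a`, the Kronecker delta collapses the sum over `b`, leaving the Lagrangian term to
  -- be compared apart from the momentum term.
  simp only [sub_mul, Finset.sum_sub_distrib, ite_mul, zero_mul, Finset.sum_ite_eq,
    Finset.mem_univ, if_true]
  rw [sub_eq_add_neg]
  congr 1
  · ring
  -- The minus sign in front of `P^a^c ∇_b κ_c` comes from the value of the contact form on `Y`;
  -- what is left is to exchange the sums over `b` and `c`.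
  · simp only [j.contact_eq_neg_nabla S Y hY, map_neg, map_sum, map_smul, smul_eq_mul, neg_mul,
      Finset.sum_neg_distrib, Finset.sum_mul]
    rw [Finset.sum_comm]
    exact congrArg _ (Finset.sum_congr rfl fun c _ => Finset.sum_congr rfl fun b _ => by ring)

end contraction

end GaugeBundle

end YangMills

/-! ### The energy-tensor of a gauge field. -/

theorem mainTheorem4 {n d : ℕ} {M : Type*} [TopologicalSpace M] [ChartedSpace (Coord d) M]
    [IsManifold (𝓡 (d + 1)) ∞ M] (S : Background d M) {G : Subgroup (EndFib n)ˣ} {ι : Type*}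
    (Z : GaugeBundle d M G ι) (κ : Z.Field) (X : ∀ x : M, TBase d x)
    (p : Z.Index) (x : M) (hx : x ∈ Z.connCore.baseSet p) :
    GaugeBundle.energyTensor S p (κ.jet x) (X x) =
      κ.pullback (GaugeBundle.interior (GaugeBundle.horLift S p κ X)
        (GaugeBundle.poincareCartan S p)) x := by
  have hproj : Z.dproj (κ.toMap x) (GaugeBundle.horLift S p κ X (κ.toMap x)) = X x :=
    GaugeBundle.dproj_horLift S κ X (z := κ.toMap x) hx
  refine AlternatingMap.ext fun v => ?_
  have h := GaugeBundle.energyTensor_eq_poincareCartan S (κ.jet x) hx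
    (GaugeBundle.horLift S p κ X (κ.toMap x)) ?_ v
  -- The right-hand sides agree by unfolding: the linear part of `κ.jet x` is the tangent map of
  -- `κ`, and the interior product puts `Y` in the first slot.
  · exact (congrArg (fun w => GaugeBundle.energyTensor S p (κ.jet x) w v) hproj).symm.trans h
  -- The lift is taken at `κ(x)`, the base point of the jet, so the fibre coordinates at which the
  -- overconnection is evaluated are those of `κ` itself, as in the definition of `nabla`.
  · refine (GaugeBundle.dy_horLift S κ X (z := κ.toMap x) hx).trans ?_
    exact congrArg (fun w => alongCoord (overComp S p.2.1 x ((κ.jet x).y p) ((κ.jet x).s p)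
      ((κ.jet x).y p)) (dx p.2.1 x w)) hproj.symm
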